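/- **Theorem.** Let $\mathcal H$ be a finite-dimensional complex Hilbert space, $\hbar>0$, and let $\sigma=(\lambda_1>\dots>\lambda_k>0;\,m_1,\dots,m_k)$, with integers $m_j\ge 1$ and $\sum_j m_j\lambda_j=1$. Let $\mathcal D(\sigma)$ be the set of density operators on $\mathcal H$ whose nonzero eigenvalues are exactly the $\lambda_j$, with multiplicities $m_j$. Let $\mathcal K=\mathbb C^{m_1+\dots+m_k}$, let $P(\sigma)$ be the diagonal operator on $\mathcal K$ with $m_j$ consecutive entries $\lambda_j$ for $j=1,\dots,k$, put $\mathcal S(\sigma)=\{\psi\in\mathcal L(\mathcal K,\mathcal H):\psi^\dagger\psi=P(\sigma)\}$ and $\pi:\mathcal S(\sigma)\to\mathcal D(\sigma)$, $\pi(\psi)=\psi\psi^\dagger$. Equip $\mathcal S(\sigma)$ with the metric $G(X,Y)=\tfrac12\mathrm{Tr}(X^\dagger Y+Y^\dagger X)$ (the real part of the Hilbert–Schmidt inner product), call a tangent vector of $\mathcal S(\sigma)$ horizontal if it is $G$-orthogonal to $\ker d\pi$, and let $g$ be the metric on $\mathcal D(\sigma)$ that makes $\pi$ a Riemannian submersion.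 For a $C^1$ curve $\rho:[0,T]\to\mathcal D(\sigma)$ let $\mathrm{Length}[\rho]=\int_0^T\sqrt{g(\dot\rho,\dot\rho)}\,dt$, and let $\mathrm{Dist}(\rho_0,\rho_1)$ be the infimum of the lengths of all $C^1$ curves in $\mathcal D(\sigma)$ from $\rho_0$ to $\rho_1$. Let $\rho_0,\rho_1\in\mathcal D(\sigma)$ and $\tau>0$. Consider the pairs $(\hat H,\rho)$ of a continuous family $\hat H(t)$, $t\in[0,\tau]$, of self-adjoint operators on $\mathcal H$ and a curve $\rho:[0,\tau]\to\mathcal D(\sigma)$ that solve the von Neumann boundary value problem $$\dot\rho(t)=\frac1{i\hbar}[\hat H(t),\rho(t)],\qquad \rho(0)=\rho_0,\quad \rho(\tau)=\rho_1 ,$$ and let $\Delta H(\rho)=\sqrt{\mathrm{Tr}(\hat H^2\rho)-\mathrm{Tr}(\hat H\rho)^2}$. Then such pairs exist, and 1. $\displaystyle \mathrm{Dist}(\rho_0,\rho_1)=\inf_{\hat H}\frac1\hbar\int_0^\tau\Delta H(\rho)\,dt$, the infimum being over all such pairs; 2. $\displaystyle \mathrm{Length}[\rho]\le\frac1\hbar\int_0^\tau\Delta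 H(\rho)\,dt$ for every such pair; 3. equality holds in 2 whenever $\hat H$ generates a horizontal lift of $\rho$, i.e. whenever some solution $\psi:[0,\tau]\to\mathcal S(\sigma)$ of $\dot\psi=\frac1{i\hbar}\hat H\psi$ satisfies $\pi(\psi(t))=\rho(t)$ and has horizontal velocity for all $t$; 4. if $G$ is replaced by $\hbar\,\mathrm{Tr}(X^\dagger Y+Y^\dagger X)$, the distance becomes $\sqrt{2\hbar}\,\inf_{\hat H}\frac1\hbar\int_0^\tau\Delta H(\rho)\,dt$. -/

import Mathlib

open scoped InnerProduct

namespace MixedState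

noncomputable section

/-- The spectrum `σ = (λ₁, …, λ_k; m₁, …, m_k)` of a density operator: the distinct nonzero
eigenvalues in decreasing order, with their multiplicities. -/
structure Spectrum where
  /-- number of distinct nonzero eigenvalues -/
  k : ℕ
  /-- the eigenvalues -/
  eig : Fin k → ℝ
  /-- the multiplicities -/
  mult : Fin k → ℕ
  eig_pos : ∀ j, 0 < eig j
  eig_strictAnti : StrictAnti eig
  mult_pos : ∀ j, 0 < mult j
  sum_eq_one : ∑ j, (mult j : ℝ) * eig j = 1

/-- The auxiliary Hilbert space `𝒦`, of dimension `m₁ + ⋯ + m_k`; the index `⟨j, i⟩` is the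
`i`-th basis vector of the `j`-th block. -/
abbrev Aux (σ : Spectrum) : Type :=
  EuclideanSpace ℂ (Σ j : Fin σ.k, Fin (σ.mult j))

/-- `Π_j`: the orthogonal projection of `𝒦` onto the span of the `j`-th block. -/
def blockProj (σ : Spectrum) (j : Fin σ.k) : Aux σ →L[ℂ] Aux σ :=
  ∑ i : Fin (σ.mult j),
    InnerProductSpace.rankOne ℂ (EuclideanSpace.single (⟨j, i⟩ : Σ j, Fin (σ.mult j)) (1 : ℂ))
      (EuclideanSpace.single (⟨j, i⟩ : Σ j, Fin (σ.mult j)) (1 : ℂ))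

/-- `P(σ) = ∑_j λ_j Π_j`. -/
def specOp (σ : Spectrum) : Aux σ →L[ℂ] Aux σ :=
  ∑ j, (σ.eig j : ℂ) • blockProj σ j

/-- The trace of an operator. -/
def tr {E : Type*} [NormedAddCommGroup E] [InnerProductSpace ℂ E] (A : E →L[ℂ] E) : ℂ :=
  LinearMap.trace ℂ E (A : E →ₗ[ℂ] E)

variable {H : Type*} [NormedAddCommGroup H] [InnerProductSpace ℂ H] [CompleteSpace H]

/-- `𝒟(σ)`: the density operators on `ℋ` (positive, of trace one) with spectrum `σ`. -/
def isospectral (H : Type*) [NormedAddCommGroup H] [InnerProductSpace ℂ H]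
    (σ : Spectrum) : Set (H →L[ℂ] H) :=
  {ρ | ρ.IsPositive ∧ tr ρ = 1 ∧
    (∀ j, Module.finrank ℂ (Module.End.eigenspace (ρ : H →ₗ[ℂ] H) (σ.eig j : ℂ)) = σ.mult j) ∧
    (∀ μ : ℂ, μ ≠ 0 → Module.End.HasEigenvalue (ρ : H →ₗ[ℂ] H) μ → ∃ j, μ = (σ.eig j : ℂ))}

/-- `𝒮(σ) = {ψ ∈ ℒ(𝒦, ℋ) : ψ†ψ = P(σ)}`. -/
def purifications (H : Type*) [NormedAddCommGroup H] [InnerProductSpace ℂ H] [CompleteSpace H]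
    (σ : Spectrum) : Set (Aux σ →L[ℂ] H) :=
  {ψ | ψ† ∘L ψ = specOp σ}

/-- The bundle projection `π(ψ) = ψψ†`. -/
def proj {σ : Spectrum} (ψ : Aux σ →L[ℂ] H) : H →L[ℂ] H := ψ ∘L ψ†

/-- The differential `dπ_ψ(X) = Xψ† + ψX†` of the bundle projection. -/
def dproj {σ : Spectrum} (ψ X : Aux σ →L[ℂ] H) : H →L[ℂ] H := X ∘L ψ† + ψ ∘L X†

/-- The metric `G(X, Y) = (c/2) Tr(X†Y + Y†X)` on `ℒ(𝒦, ℋ)`, that is `c` times the real part of the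
Hilbert–Schmidt inner product. -/
def hsMetric (c : ℝ) {σ : Spectrum} (X Y : Aux σ →L[ℂ] H) : ℝ :=
  c / 2 * (tr (X† ∘L Y + Y† ∘L X)).re

/-- The tangent space `T_ψ 𝒮(σ)`: the kernel of the differential of `ψ ↦ ψ†ψ`. -/
def tangent {σ : Spectrum} (ψ : Aux σ →L[ℂ] H) : Set (Aux σ →L[ℂ] H) :=
  {X | X† ∘L ψ + ψ† ∘L X = 0}

/-- The vertical space `V_ψ = ker dπ_ψ` in `T_ψ 𝒮(σ)`. -/
def vertical {σ : Spectrum} (ψ : Aux σ →L[ℂ] H) : Set (Aux σ →L[ℂ] H) :=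
  {X | X ∈ tangent ψ ∧ dproj ψ X = 0}

/-- The horizontal space: the orthogonal complement of `V_ψ` in `T_ψ 𝒮(σ)` with respect to `G`. -/
def horizontal (c : ℝ) {σ : Spectrum} (ψ : Aux σ →L[ℂ] H) : Set (Aux σ →L[ℂ] H) :=
  {X | X ∈ tangent ψ ∧ ∀ Y ∈ vertical ψ, hsMetric c X Y = 0}

open Classical in
/-- The metric `g` on `𝒟(σ)` that makes `π` a Riemannian submersion: `g_ρ(v, w) = G(X, Y)` for
horizontal vectors `X`, `Y` at a point `ψ` over `ρ` with `dπ_ψ(X) = v` and `dπ_ψ(Y) = w`.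
By `metric_dproj` below this does not depend on the choice of `ψ`, `X`, `Y`. -/
def metric (c : ℝ) (σ : Spectrum) (ρ v w : H →L[ℂ] H) : ℝ :=
  if h : ∃ r : ℝ, ∃ ψ ∈ purifications H σ, ∃ X ∈ horizontal c ψ, ∃ Y ∈ horizontal c ψ,
      proj ψ = ρ ∧ dproj ψ X = v ∧ dproj ψ Y = w ∧ r = hsMetric c X Y
  then h.choose else 0

theorem blockProj_apply (σ : Spectrum) (j : Fin σ.k) (x : Aux σ) (a : Σ j, Fin (σ.mult j)) :
    blockProj σ j x a = if a.1 = j then x a else 0 := by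
  obtain ⟨j', i'⟩ := a
  simp only [blockProj, sum_apply, InnerProductSpace.rankOne_apply,
    EuclideanSpace.inner_single_left, WithLp.ofLp_sum, Finset.sum_apply]
  by_cases h : j' = j
  · subst h
    simp
  · simp [h]

theorem specOp_apply (σ : Spectrum) (x : Aux σ) (a : Σ j, Fin (σ.mult j)) :
    specOp σ x a = (σ.eig a.1 : ℂ) * x a := by
  simp [specOp, blockProj_apply]

theorem exists_specOp_inverse (σ : Spectrum) : ∃ Q : Aux σ →L[ℂ] Aux σ,
    specOp σ ∘L Q = ContinuousLinearMap.id ℂ _ ∧ Q ∘L specOp σ = ContinuousLinearMap.id ℂ _ := by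
  have hne : ∀ j, (σ.eig j : ℂ) ≠ 0 := fun j => by exact_mod_cast (σ.eig_pos j).ne'
  refine ⟨∑ j, ((σ.eig j : ℂ))⁻¹ • blockProj σ j, ?_, ?_⟩
  · ext x a
    simp [specOp_apply, blockProj_apply, hne]
  · ext x a
    simp [specOp_apply, blockProj_apply, hne]

theorem tr_comm_comp {σ : Spectrum} (A B : Aux σ →L[ℂ] Aux σ) : tr (A ∘L B) = tr (B ∘L A) :=
  LinearMap.trace_mul_comm ℂ (A : Aux σ →ₗ[ℂ] Aux σ) B

theorem comp_eq_id_symm {σ : Spectrum} {A B : Aux σ →L[ℂ] Aux σ}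
    (h : A ∘L B = ContinuousLinearMap.id ℂ _) : B ∘L A = ContinuousLinearMap.id ℂ _ := by
  have h1 : (A : Aux σ →ₗ[ℂ] Aux σ) * (B : Aux σ →ₗ[ℂ] Aux σ) = 1 :=
    congrArg (fun C : Aux σ →L[ℂ] Aux σ => (C : Aux σ →ₗ[ℂ] Aux σ)) h
  exact ContinuousLinearMap.coe_injective (mul_eq_one_comm.1 h1)

theorem tr_add {σ : Spectrum} (A B : Aux σ →L[ℂ] Aux σ) : tr (A + B) = tr A + tr B := by
  simp [tr]

theorem eq_zero_of_hsMetric {c : ℝ} (hc : 0 < c) {σ : Spectrum} {Z : Aux σ →L[ℂ] H}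
    (h : hsMetric c Z Z = 0) : Z = 0 := by
  have h1 : tr (Z† ∘L Z) = ∑ a, ((‖Z (EuclideanSpace.basisFun _ ℂ a)‖ ^ 2 : ℝ) : ℂ) := by
    rw [tr, LinearMap.trace_eq_sum_inner _ (EuclideanSpace.basisFun _ ℂ)]
    refine Finset.sum_congr rfl fun a _ => ?_
    rw [ContinuousLinearMap.coe_coe, ContinuousLinearMap.comp_apply,
      ContinuousLinearMap.adjoint_inner_right, inner_self_eq_norm_sq_to_K]
    push_cast
    rfl
  have h2 : ∑ a, ‖Z (EuclideanSpace.basisFun _ ℂ a)‖ ^ 2 = 0 := by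
    rw [hsMetric, tr_add, h1, ← Complex.ofReal_sum, ← Complex.ofReal_add, Complex.ofReal_re] at h
    have := (mul_eq_zero.1 h).resolve_left (by positivity)
    linarith
  rw [Finset.sum_eq_zero_iff_of_nonneg (fun _ _ => by positivity)] at h2
  refine ContinuousLinearMap.coe_injective ((EuclideanSpace.basisFun _ ℂ).toBasis.ext fun a => ?_)
  have := h2 a (Finset.mem_univ a)
  simpa using this

theorem hsMetric_comp {c : ℝ} {σ : Spectrum} (X Y : Aux σ →L[ℂ] H) (U : Aux σ →L[ℂ] Aux σ) :
    hsMetric c (X ∘L U) Y = hsMetric c X (Y ∘L U†) := by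
  simp only [hsMetric, tr_add, ContinuousLinearMap.adjoint_comp, ContinuousLinearMap.adjoint_adjoint]
  rw [ContinuousLinearMap.comp_assoc, tr_comm_comp, ContinuousLinearMap.comp_assoc,
    ← ContinuousLinearMap.comp_assoc _ X U, tr_comm_comp (Y† ∘L X) U,
    ContinuousLinearMap.comp_assoc]

theorem tangent_comp {σ : Spectrum} {ψ X : Aux σ →L[ℂ] H} (hX : X ∈ tangent ψ)
    (U : Aux σ →L[ℂ] Aux σ) : X ∘L U ∈ tangent (ψ ∘L U) := by
  have h : U† ∘L (X† ∘L ψ + ψ† ∘L X) ∘L U = 0 := by rw [show _ = _ from hX]; simp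
  simpa only [tangent, Set.mem_ofPred_eq, ContinuousLinearMap.adjoint_comp,
    ContinuousLinearMap.comp_assoc, ContinuousLinearMap.add_comp,
    ContinuousLinearMap.comp_add] using h

theorem dproj_comp {σ : Spectrum} (ψ X : Aux σ →L[ℂ] H) {U : Aux σ →L[ℂ] Aux σ}
    (hU : U ∘L U† = ContinuousLinearMap.id ℂ _) : dproj (ψ ∘L U) (X ∘L U) = dproj ψ X := by
  have h (A : H →L[ℂ] Aux σ) : U ∘L U† ∘L A = A := by
    rw [← ContinuousLinearMap.comp_assoc, hU, ContinuousLinearMap.id_comp]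
  simp only [dproj, ContinuousLinearMap.adjoint_comp, ContinuousLinearMap.comp_assoc, h]

theorem horizontal_comp {c : ℝ} {σ : Spectrum} {ψ X : Aux σ →L[ℂ] H} (hX : X ∈ horizontal c ψ)
    {U : Aux σ →L[ℂ] Aux σ} (hU : U ∘L U† = ContinuousLinearMap.id ℂ _) :
    X ∘L U ∈ horizontal c (ψ ∘L U) := by
  have hU2 : U† ∘L U = ContinuousLinearMap.id ℂ _ := by
    exact comp_eq_id_symm hU
  have e : (ψ ∘L U) ∘L U† = ψ := by
    rw [ContinuousLinearMap.comp_assoc, hU, ContinuousLinearMap.comp_id]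
  refine ⟨tangent_comp hX.1 U, fun Y hY => ?_⟩
  rw [hsMetric_comp]
  refine hX.2 _ ⟨?_, ?_⟩
  · have := tangent_comp hY.1 (U†)
    rwa [e] at this
  · have := dproj_comp (ψ ∘L U) Y (U := U†) (by rw [ContinuousLinearMap.adjoint_adjoint, hU2])
    rw [e] at this
    rw [this, hY.2]

theorem dproj_injOn_horizontal {c : ℝ} (hc : 0 < c) {σ : Spectrum} {ψ X Y : Aux σ →L[ℂ] H}
    (hX : X ∈ horizontal c ψ) (hY : Y ∈ horizontal c ψ) (h : dproj ψ X = dproj ψ Y) : X = Y := by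
  have hv : X - Y ∈ vertical ψ := by
    constructor
    · have h1 : X† ∘L ψ + ψ† ∘L X = 0 := hX.1
      have h2 : Y† ∘L ψ + ψ† ∘L Y = 0 := hY.1
      change (X - Y)† ∘L ψ + ψ† ∘L (X - Y) = 0
      rw [map_sub, ContinuousLinearMap.sub_comp, ContinuousLinearMap.comp_sub,
        sub_add_sub_comm, h1, h2, sub_zero]
    · rw [dproj, map_sub, ContinuousLinearMap.sub_comp, ContinuousLinearMap.comp_sub,
        sub_add_sub_comm]
      exact sub_eq_zero.2 h
  have h3 : hsMetric c (X - Y) (X - Y) = hsMetric c X (X - Y) - hsMetric c Y (X - Y) := by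
    simp only [hsMetric, map_sub, ContinuousLinearMap.sub_comp, ContinuousLinearMap.comp_sub, tr,
      map_add, ContinuousLinearMap.toLinearMap_add, ContinuousLinearMap.toLinearMap_sub,
      Complex.add_re, Complex.sub_re]
    ring
  rw [hX.2 _ hv, hY.2 _ hv, sub_zero] at h3
  exact sub_eq_zero.1 (eq_zero_of_hsMetric hc h3)

/-- Two points of `𝒮(σ)` in the same fibre differ by a unitary of `𝒦`. -/
theorem exists_unitary_of_proj_eq {σ : Spectrum} {ψ φ : Aux σ →L[ℂ] H}
    (hψ : ψ ∈ purifications H σ) (hφ : φ ∈ purifications H σ) (h : proj ψ = proj φ) :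
    ∃ U : Aux σ →L[ℂ] Aux σ, U ∘L U† = ContinuousLinearMap.id ℂ _ ∧ ψ ∘L U = φ := by
  obtain ⟨Q, hQ, hQ2⟩ := exists_specOp_inverse σ
  have hψ : ψ† ∘L ψ = specOp σ := hψ
  have hφ : φ† ∘L φ = specOp σ := hφ
  have h : ψ ∘L ψ† = φ ∘L φ† := h
  have hP : (specOp σ)† = specOp σ := by
    rw [← hψ, ContinuousLinearMap.adjoint_comp, ContinuousLinearMap.adjoint_adjoint]
  have e1 : ψ ∘L (ψ† ∘L φ ∘L Q) = φ := by
    calc ψ ∘L (ψ† ∘L φ ∘L Q) = (ψ ∘L ψ†) ∘L φ ∘L Q := by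
          simp only [ContinuousLinearMap.comp_assoc]
      _ = φ ∘L ((φ† ∘L φ) ∘L Q) := by rw [h]; simp only [ContinuousLinearMap.comp_assoc]
      _ = φ := by rw [hφ, hQ, ContinuousLinearMap.comp_id]
  have e2 : (ψ† ∘L φ ∘L Q)† ∘L (ψ† ∘L φ ∘L Q) = ContinuousLinearMap.id ℂ _ := by
    calc (ψ† ∘L φ ∘L Q)† ∘L (ψ† ∘L φ ∘L Q)
        = Q† ∘L φ† ∘L (ψ ∘L (ψ† ∘L φ ∘L Q)) := by
          simp only [ContinuousLinearMap.adjoint_comp, ContinuousLinearMap.adjoint_adjoint,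
            ContinuousLinearMap.comp_assoc]
      _ = (specOp σ ∘L Q)† := by
          rw [e1, hφ, ContinuousLinearMap.adjoint_comp, hP]
      _ = _ := by rw [hQ]; exact ContinuousLinearMap.adjoint_id
  exact ⟨_, comp_eq_id_symm e2, e1⟩

/-- `dπ` restricted to each horizontal space is an isometry onto its image. -/
theorem metric_dproj {c : ℝ} (hc : 0 < c) {σ : Spectrum} {ψ X Y : Aux σ →L[ℂ] H}
    (hψ : ψ ∈ purifications H σ) (hX : X ∈ horizontal c ψ) (hY : Y ∈ horizontal c ψ) :
    metric c σ (proj ψ) (dproj ψ X) (dproj ψ Y) = hsMetric c X Y := by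
  have hex : ∃ r : ℝ, ∃ φ ∈ purifications H σ, ∃ X' ∈ horizontal c φ, ∃ Y' ∈ horizontal c φ,
      proj φ = proj ψ ∧ dproj φ X' = dproj ψ X ∧ dproj φ Y' = dproj ψ Y ∧ r = hsMetric c X' Y' :=
    ⟨_, ψ, hψ, X, hX, Y, hY, rfl, rfl, rfl, rfl⟩
  rw [metric, dif_pos hex]
  obtain ⟨φ, hφ, X', hX', Y', hY', hp, hx, hy, hr⟩ := hex.choose_spec
  obtain ⟨U, hU, rfl⟩ := exists_unitary_of_proj_eq hψ hφ hp.symm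
  have eX : X' = X ∘L U :=
    dproj_injOn_horizontal hc hX' (horizontal_comp hX hU) (by rw [hx, dproj_comp _ _ hU])
  have eY : Y' = Y ∘L U :=
    dproj_injOn_horizontal hc hY' (horizontal_comp hY hU) (by rw [hy, dproj_comp _ _ hU])
  rw [hr, eX, eY, hsMetric_comp, ContinuousLinearMap.comp_assoc, hU, ContinuousLinearMap.comp_id]

/-- The length `∫₀ᵀ √g(γ̇, γ̇) dt` of a curve in `𝒟(σ)`. -/
def length (c : ℝ) (σ : Spectrum) (T : ℝ) (γ : ℝ → H →L[ℂ] H) : ℝ :=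
  ∫ t in (0 : ℝ)..T, √(metric c σ (γ t) (derivWithin γ (Set.Icc 0 T) t)
    (derivWithin γ (Set.Icc 0 T) t))

/-- `γ : [0, T] → 𝒟(σ)` is a `C¹` curve from `ρ₀` to `ρ₁`. -/
structure IsCurve (σ : Spectrum) (T : ℝ) (ρ₀ ρ₁ : H →L[ℂ] H) (γ : ℝ → H →L[ℂ] H) : Prop where
  contDiffOn : ContDiffOn ℝ 1 γ (Set.Icc 0 T)
  mem : ∀ t ∈ Set.Icc 0 T, γ t ∈ isospectral H σ
  left : γ 0 = ρ₀
  right : γ T = ρ₁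

/-- The geodesic distance on `𝒟(σ)`: the infimum of the lengths of all curves joining `ρ₀` to
`ρ₁`. -/
def geodesicDist (c : ℝ) (σ : Spectrum) (ρ₀ ρ₁ : H →L[ℂ] H) : ℝ :=
  sInf {r | ∃ T : ℝ, 0 < T ∧ ∃ γ : ℝ → H →L[ℂ] H, IsCurve σ T ρ₀ ρ₁ γ ∧ r = length c σ T γ}

/-- The Hamiltonian vector field `X_H(ρ) = (1 / iħ) [Ĥ, ρ]`. -/
def hamField (ħ : ℝ) (A ρ : H →L[ℂ] H) : H →L[ℂ] H :=
  (1 / (Complex.I * (ħ : ℂ))) • (A ∘L ρ - ρ ∘L A)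

/-- The lifted vector field `X_Ĥ(ψ) = (1 / iħ) Ĥψ`. -/
def hamLift (ħ : ℝ) {σ : Spectrum} (A : H →L[ℂ] H) (ψ : Aux σ →L[ℂ] H) : Aux σ →L[ℂ] H :=
  (1 / (Complex.I * (ħ : ℂ))) • (A ∘L ψ)

/-- The uncertainty `ΔH(ρ) = √(Tr(Ĥ²ρ) − Tr(Ĥρ)²)`. -/
def uncertainty (A ρ : H →L[ℂ] H) : ℝ :=
  √((tr (A ∘L A ∘L ρ)).re - (tr (A ∘L ρ)).re ^ 2)

/-- The (time-dependent, continuous) Hamiltonian `Ĥ` and the curve `ρ : [0, τ] → 𝒟(σ)` solve the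
von Neumann boundary value problem `ρ̇ = X_H(ρ)`, `ρ(0) = ρ₀`, `ρ(τ) = ρ₁`. -/
structure IsVonNeumann (ħ : ℝ) (σ : Spectrum) (τ : ℝ) (ρ₀ ρ₁ : H →L[ℂ] H)
    (A ρ : ℝ → H →L[ℂ] H) : Prop where
  selfAdjoint : ∀ t ∈ Set.Icc 0 τ, IsSelfAdjoint (A t)
  continuousOn : ContinuousOn A (Set.Icc 0 τ)
  mem : ∀ t ∈ Set.Icc 0 τ, ρ t ∈ isospectral H σ
  eqn : ∀ t ∈ Set.Icc 0 τ, HasDerivWithinAt ρ (hamField ħ (A t) (ρ t)) (Set.Icc 0 τ) t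
  left : ρ 0 = ρ₀
  right : ρ τ = ρ₁

/-- `(1/ħ) ∫₀^τ ΔH(ρ(t)) dt`. -/
def energyIntegral (ħ τ : ℝ) (A ρ : ℝ → H →L[ℂ] H) : ℝ :=
  1 / ħ * ∫ t in (0 : ℝ)..τ, uncertainty (A t) (ρ t)

/-- `Ĥ` generates a horizontal lift of `ρ`: some solution of `ψ̇ = X_Ĥ(ψ)` in `𝒮(σ)` lies over `ρ`
and has horizontal velocity. -/
def GeneratesHorizontalLift (c ħ : ℝ) (σ : Spectrum) (τ : ℝ) (A ρ : ℝ → H →L[ℂ] H) : Prop :=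
  ∃ ψ : ℝ → Aux σ →L[ℂ] H, ∀ t ∈ Set.Icc 0 τ,
    ψ t ∈ purifications H σ ∧ proj (ψ t) = ρ t ∧
    HasDerivWithinAt ψ (hamLift ħ (A t) (ψ t)) (Set.Icc 0 τ) t ∧
    hamLift ħ (A t) (ψ t) ∈ horizontal c (ψ t)

end

end MixedState

/-!
Adding to `Ĥ` an operator that commutes with the spectral projections of `ρ` does not change the
velocity `[Ĥ, ρ] / iħ`. The off-diagonal part of `Ĥ`, obtained by subtracting the pinching
`∑ a, E_a Ĥ E_a`, lifts to a horizontal vector over this velocity, because `Y ψ†` commutes with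
`ρ = ψ ψ†` for every vertical vector `Y` at `ψ`. The norm of this horizontal vector is `1/ħ` times
the uncertainty of the off-diagonal part, which is at most `ΔH`; hence the bound on the length.
Conversely, the velocity of a `C¹` curve in `𝒟(σ)` is always off-diagonal, and inverting
`x ↦ [x, ρ]` on the off-diagonal operators produces a Hamiltonian for which equality holds.
Von Neumann evolutions from `ρ₀` to `ρ₁` exist because isospectral operators are conjugate by a
unitary operator, which is the exponential of a skew-adjoint one.
-/

namespace MixedState

noncomputable section

section Pinching

variable {ι R : Type*}

/-- The diagonal blocks of `A` with respect to the family of idempotents `e` vanish. -/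
def IsOffDiagonal [Semiring R] (e : ι → R) (A : R) : Prop := ∀ i, e i * A * e i = 0

theorem IsOffDiagonal.smul {K : Type*} [CommSemiring K] [Semiring R] [Algebra K R] {e : ι → R}
    {A : R} (hA : IsOffDiagonal e A) (z : K) : IsOffDiagonal e (z • A) := fun i => by
  rw [mul_smul_comm, smul_mul_assoc, hA i, smul_zero]

variable [Fintype ι]

/-- The part of `A` that is block diagonal for a family `e` of orthogonal idempotents. -/
def pinching [Semiring R] (e : ι → R) (A : R) : R := ∑ i, e i * A * e i

theorem mul_pinching [Semiring R] {e : ι → R} (he : OrthogonalIdempotents e) (A : R) (i : ι) :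
    e i * pinching e A = e i * A * e i := by
  classical
  simp only [pinching, Finset.mul_sum, ← mul_assoc, he.mul_eq, ite_mul, zero_mul,
    Finset.sum_ite_eq, Finset.mem_univ, if_true]

theorem pinching_mul [Semiring R] {e : ι → R} (he : OrthogonalIdempotents e) (A : R) (i : ι) :
    pinching e A * e i = e i * A * e i := by
  classical
  simp only [pinching, Finset.sum_mul, mul_assoc, he.mul_eq, mul_ite, mul_zero,
    Finset.sum_ite_eq', Finset.mem_univ, if_true]

theorem commute_pinching [Semiring R] {e : ι → R} (he : OrthogonalIdempotents e) (A : R)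
    (i : ι) : Commute (e i) (pinching e A) :=
  (mul_pinching he A i).trans (pinching_mul he A i).symm

theorem isOffDiagonal_sub_pinching [Ring R] {e : ι → R} (he : OrthogonalIdempotents e) (A : R) :
    IsOffDiagonal e (A - pinching e A) := fun i => by
  rw [mul_sub, sub_mul, mul_pinching he, mul_assoc _ (e i), (he.idem i).eq, sub_self]

theorem isSelfAdjoint_pinching [Semiring R] [StarRing R] {e : ι → R}
    (he : ∀ i, IsSelfAdjoint (e i)) {A : R} (hA : IsSelfAdjoint A) :
    IsSelfAdjoint (pinching e A) := by
  rw [pinching, isSelfAdjoint_iff, star_sum]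
  exact Finset.sum_congr rfl fun i _ => by
    rw [star_mul, star_mul, (he i).star_eq, hA.star_eq, mul_assoc]

theorem ext_of_mul_mul_eq [Semiring R] {e : ι → R} (he : CompleteOrthogonalIdempotents e)
    {A B : R} (h : ∀ i j, e i * A * e j = e i * B * e j) : A = B := by
  have hsum (C : R) : ∑ i, ∑ j, e i * C * e j = C := by
    simp only [← Finset.mul_sum, ← Finset.sum_mul, he.complete, mul_one, one_mul]
  rw [← hsum A, ← hsum B]
  simp only [h]

theorem map_mul_eq_zero_of_isOffDiagonal [Semiring R] {M F : Type*} [AddCommMonoid M]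
    [FunLike F R M] [AddMonoidHomClass F R M] {e : ι → R} (he : CompleteOrthogonalIdempotents e)
    {φ : F} (hφ : ∀ A B, φ (A * B) = φ (B * A)) {B C : R} (hB : IsOffDiagonal e B)
    (hC : ∀ i, Commute (e i) C) : φ (B * C) = 0 := by
  rw [← mul_one (B * C), ← he.complete, Finset.mul_sum, map_sum]
  refine Finset.sum_eq_zero fun i _ => ?_
  calc φ (B * C * e i) = φ (B * e i * C * e i) := by
        conv_lhs => rw [← (he.idem i).eq]
        simp only [mul_assoc, (hC i).eq]
    _ = φ (e i * B * e i * C) := by rw [hφ]; simp only [mul_assoc]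
    _ = 0 := by rw [hB i, zero_mul, map_zero]

end Pinching

section SpectralResolution

variable {ι K R : Type*} [Fintype ι] [Field K] [Ring R] [Algebra K R]

/-- `ρ = ∑ i, μ i • e i`, with distinct eigenvalues `μ i` and complete orthogonal idempotents
`e i`, some of which may vanish. -/
structure IsSpectralResolution (e : ι → R) (μ : ι → K) (ρ : R) : Prop
    extends CompleteOrthogonalIdempotents e where
  injective : Function.Injective μ
  sum_smul : ∑ i, μ i • e i = ρ

/-- The inverse of the commutator `x ↦ x * ρ - ρ * x` on the off-diagonal elements, for
`ρ = ∑ i, μ i • e i`. The terms with `i = j` vanish because `0⁻¹ = 0`. -/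
def commutatorInv (e : ι → R) (μ : ι → K) (v : R) : R :=
  ∑ i, ∑ j, (μ j - μ i)⁻¹ • (e i * v * e j)

variable {e : ι → R} {μ : ι → K} {ρ : R}

theorem mul_commutatorInv_mul (he : OrthogonalIdempotents e) (μ : ι → K) (v : R) (i j : ι) :
    e i * commutatorInv e μ v * e j = (μ j - μ i)⁻¹ • (e i * v * e j) := by
  classical
  have hblock (k l : ι) : e i * (e k * v * e l) * e j =
      if i = k then if l = j then e i * v * e j else 0 else 0 := by
    rw [← mul_assoc, ← mul_assoc, he.mul_eq, mul_assoc _ (e l), he.mul_eq]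
    split_ifs with hk hl <;> simp [*]
  simp only [commutatorInv, Finset.mul_sum, Finset.sum_mul, mul_smul_comm, smul_mul_assoc, hblock]
  simp

theorem isOffDiagonal_commutatorInv (he : OrthogonalIdempotents e) (μ : ι → K) (v : R) :
    IsOffDiagonal e (commutatorInv e μ v) := fun i => by
  rw [mul_commutatorInv_mul he, sub_self, inv_zero, zero_smul]

theorem star_commutatorInv [StarRing K] [TrivialStar K] [StarRing R] [StarModule K R]
    (he : ∀ i, IsSelfAdjoint (e i)) (μ : ι → K) {v : R} (hv : IsSelfAdjoint v) :
    star (commutatorInv e μ v) = -commutatorInv e μ v := by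
  simp only [commutatorInv, star_sum, star_smul, star_mul, star_trivial, hv.star_eq,
    (he _).star_eq, ← Finset.sum_neg_distrib, ← neg_smul, ← inv_neg, neg_sub, mul_assoc]
  exact Finset.sum_comm

namespace IsSpectralResolution

theorem mul_eq_smul (h : IsSpectralResolution e μ ρ) (i : ι) : ρ * e i = μ i • e i := by
  classical
  simp [← h.sum_smul, Finset.sum_mul, h.mul_eq]

theorem eq_smul_mul (h : IsSpectralResolution e μ ρ) (i : ι) : e i * ρ = μ i • e i := by
  classical
  simp [← h.sum_smul, Finset.mul_sum, h.mul_eq]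

theorem mul_eq_self_of_mul_eq_smul (h : IsSpectralResolution e μ ρ) {x : R} {i : ι}
    (hx : x * ρ = μ i • x) : x * e i = x := by
  have horth (j : ι) (hj : j ≠ i) : x * e j = 0 := by
    have hsmul : (μ i - μ j) • (x * e j) = 0 := by
      rw [sub_smul, ← smul_mul_assoc, ← hx, mul_assoc, h.mul_eq_smul, mul_smul_comm, sub_self]
    exact (smul_eq_zero.1 hsmul).resolve_left (sub_ne_zero.2 (h.injective.ne hj.symm))
  conv_rhs => rw [← mul_one x, ← h.complete, Finset.mul_sum]
  exact (Finset.sum_eq_single i (fun j _ hj => horth j hj) (by simp)).symm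

theorem commute_of_commute (h : IsSpectralResolution e μ ρ) {C : R} (hC : Commute ρ C) (i : ι) :
    Commute (e i) C := by
  have hdiag (j : ι) : e j * C * e j = e j * C := by
    refine h.mul_eq_self_of_mul_eq_smul ?_
    rw [mul_assoc, ← hC.eq, ← mul_assoc, h.eq_smul_mul, smul_mul_assoc]
  have hoff (j : ι) (hj : j ≠ i) : e j * C * e i = 0 := by
    rw [← hdiag j, mul_assoc, h.ortho hj, mul_zero]
  calc e i * C = e i * C * e i := (hdiag i).symm
    _ = ∑ j, e j * C * e i := (Finset.sum_eq_single i (fun j _ => hoff j) (by simp)).symm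
    _ = C * e i := by rw [← Finset.sum_mul, ← Finset.sum_mul, h.complete, one_mul]

protected theorem isSelfAdjoint [StarRing K] [TrivialStar K] [StarRing R] [StarModule K R]
    (h : IsSpectralResolution e μ ρ) (hρ : IsSelfAdjoint ρ) (i : ι) : IsSelfAdjoint (e i) := by
  have hmul : star (e i) * e i = star (e i) := h.mul_eq_self_of_mul_eq_smul <| by
    simpa [hρ.star_eq] using congrArg star (h.mul_eq_smul i)
  exact IsSelfAdjoint.star_iff.1 (hmul ▸ IsSelfAdjoint.star_mul_self (e i))

protected theorem commute_pinching (h : IsSpectralResolution e μ ρ) (A : R) :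
    Commute ρ (pinching e A) := by
  rw [← h.sum_smul]
  exact Commute.sum_left _ _ _ fun i _ =>
    (MixedState.commute_pinching h.toOrthogonalIdempotents A i).smul_left (μ i)

theorem commutatorInv_mul_sub_mul (h : IsSpectralResolution e μ ρ) {v : R}
    (hv : IsOffDiagonal e v) :
    commutatorInv e μ v * ρ - ρ * commutatorInv e μ v = v := by
  refine ext_of_mul_mul_eq h.toCompleteOrthogonalIdempotents fun i j => ?_
  have hblock : e i * (commutatorInv e μ v * ρ - ρ * commutatorInv e μ v) * e j =
      (μ j - μ i) • (e i * commutatorInv e μ v * e j) := by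
    rw [mul_sub, sub_mul, ← mul_assoc _ ρ, h.eq_smul_mul, mul_assoc _ (_ * ρ), mul_assoc _ ρ,
      h.mul_eq_smul]
    simp only [mul_smul_comm, smul_mul_assoc, sub_smul, mul_assoc]
  rw [hblock, mul_commutatorInv_mul h.toOrthogonalIdempotents]
  obtain rfl | hij := eq_or_ne i j
  · rw [hv i, smul_zero, smul_zero]
  · exact smul_inv_smul₀ (sub_ne_zero.2 (h.injective.ne hij.symm)) _

end IsSpectralResolution

theorem aeval_eq_zero_of_aeval_nodal_eq_zero (hμ : Function.Injective μ)
    (hρ : Polynomial.aeval ρ (Lagrange.nodal Finset.univ μ) = 0) {p : Polynomial K}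
    (hp : ∀ i, p.eval (μ i) = 0) : Polynomial.aeval ρ p = 0 := by
  have hdvd : Lagrange.nodal Finset.univ μ ∣ p :=
    Finset.prod_dvd_of_coprime (fun i _ j _ hij => Polynomial.pairwise_coprime_X_sub_C hμ hij)
      fun i _ => Polynomial.dvd_iff_isRoot.2 (hp i)
  obtain ⟨q, rfl⟩ := hdvd
  rw [map_mul, hρ, zero_mul]

theorem isSpectralResolution_aeval_basis [Nonempty ι] [DecidableEq ι] (hμ : Function.Injective μ)
    (hρ : Polynomial.aeval ρ (Lagrange.nodal Finset.univ μ) = 0) :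
    IsSpectralResolution (fun i => Polynomial.aeval ρ (Lagrange.basis Finset.univ μ i)) μ ρ := by
  have hbasis (i j : ι) : (Lagrange.basis Finset.univ μ i).eval (μ j) = if i = j then 1 else 0 := by
    split_ifs with hij
    · exact hij ▸ Lagrange.eval_basis_self hμ.injOn (Finset.mem_univ i)
    · exact Lagrange.eval_basis_of_ne hij (Finset.mem_univ j)
  refine ⟨CompleteOrthogonalIdempotents.iff_ortho_complete.2 ⟨fun i j hij => ?_, ?_⟩, hμ, ?_⟩
  · change _ * _ = _
    rw [← map_mul]
    refine aeval_eq_zero_of_aeval_nodal_eq_zero hμ hρ fun k => ?_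
    rw [Polynomial.eval_mul, hbasis, hbasis]
    split_ifs <;> simp_all
  · rw [← map_sum, Lagrange.sum_basis hμ.injOn Finset.univ_nonempty, map_one]
  · rw [← sub_eq_zero]
    have := aeval_eq_zero_of_aeval_nodal_eq_zero hμ hρ
      (p := ∑ i, μ i • Lagrange.basis Finset.univ μ i - Polynomial.X) fun k => by
        simp [Polynomial.eval_finsetSum, hbasis]
    simpa using this

end SpectralResolution

section Trace

variable {E F : Type*} [NormedAddCommGroup E] [InnerProductSpace ℂ E] [FiniteDimensional ℂ E]
  [NormedAddCommGroup F] [InnerProductSpace ℂ F] [FiniteDimensional ℂ F]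

/-- The real part of the trace, as a continuous real-linear functional. -/
def reTr (E : Type*) [NormedAddCommGroup E] [InnerProductSpace ℂ E] [FiniteDimensional ℂ E] :
    (E →L[ℂ] E) →L[ℝ] ℝ :=
  Complex.reCLM ∘L (LinearMap.toContinuousLinearMap
    (LinearMap.trace ℂ E ∘ₗ ContinuousLinearMap.coeLM ℂ)).restrictScalars ℝ

theorem reTr_apply (A : E →L[ℂ] E) : reTr E A = (tr A).re := rfl

theorem reTr_comp_comm (A : E →L[ℂ] F) (B : F →L[ℂ] E) :
    reTr F (A ∘L B) = reTr E (B ∘L A) :=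
  congrArg Complex.re (LinearMap.trace_comp_comm' (A : E →ₗ[ℂ] F) (B : F →ₗ[ℂ] E)).symm

theorem reTr_mul_comm (A B : E →L[ℂ] E) : reTr E (A * B) = reTr E (B * A) :=
  reTr_comp_comm A B

theorem uncertainty_eq_sqrt_reTr (A ρ : E →L[ℂ] E) :
    uncertainty A ρ = √(reTr E (A * A * ρ) - reTr E (A * ρ) ^ 2) := rfl

theorem uncertainty_smul {r : ℝ} (hr : 0 ≤ r) (A ρ : E →L[ℂ] E) :
    uncertainty (r • A) ρ = r * uncertainty A ρ := by
  simp only [uncertainty_eq_sqrt_reTr, smul_mul_assoc, mul_smul_comm, map_smul, smul_eq_mul]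
  rw [mul_pow, ← mul_assoc, ← sq, ← mul_sub, Real.sqrt_mul (sq_nonneg r), Real.sqrt_sq hr]

variable [CompleteSpace E]

theorem reTr_adjoint (A : E →L[ℂ] E) : reTr E (A†) = reTr E A := by
  simp only [reTr_apply, tr, LinearMap.trace_eq_sum_inner _ (stdOrthonormalBasis ℂ E),
    Complex.re_sum, ContinuousLinearMap.coe_coe, ContinuousLinearMap.adjoint_inner_right]
  exact Finset.sum_congr rfl fun i _ => inner_re_symm (𝕜 := ℂ) _ _

variable {ρ A D : E →L[ℂ] E}

theorem sq_reTr_mul_le (hρ : ρ.IsPositive) (htr : reTr E ρ = 1) (hD : IsSelfAdjoint D) :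
    reTr E (D * ρ) ^ 2 ≤ reTr E (D * D * ρ) := by
  set d := reTr E (D * ρ) with hd
  have hC : IsSelfAdjoint (D - d • (1 : E →L[ℂ] E)) :=
    hD.sub (IsSelfAdjoint.smul (.all d) (.one _))
  have hpos : 0 ≤ reTr E ((D - d • (1 : E →L[ℂ] E)) * ((D - d • (1 : E →L[ℂ] E)) * ρ)) := by
    have hconj := hρ.conj_adjoint (D - d • (1 : E →L[ℂ] E))
    rw [hC.adjoint_eq] at hconj
    rw [reTr_mul_comm, mul_assoc]
    exact (Complex.nonneg_iff.1 hconj.toLinearMap.trace_nonneg).1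
  have hexpand : (D - d • (1 : E →L[ℂ] E)) * ((D - d • (1 : E →L[ℂ] E)) * ρ) =
      D * D * ρ - (2 * d) • (D * ρ) + d ^ 2 • ρ := by
    simp only [sub_mul, mul_sub, smul_mul_assoc, one_mul, mul_smul_comm, smul_sub, smul_smul,
      mul_assoc]
    module
  rw [hexpand, map_add, map_sub, map_smul, map_smul, htr, ← hd, smul_eq_mul, smul_eq_mul] at hpos
  linarith

theorem uncertainty_sub_pinching_le (hρ : ρ.IsPositive) (htr : reTr E ρ = 1) {ι : Type*}
    [Fintype ι] {e : ι → E →L[ℂ] E} {μ : ι → ℝ} (h : IsSpectralResolution e μ ρ)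
    (hA : IsSelfAdjoint A) : uncertainty (A - pinching e A) ρ ≤ uncertainty A ρ := by
  have he := h.toOrthogonalIdempotents
  set D := pinching e A
  set B := A - D
  have hsum : A = B + D := (sub_add_cancel A D).symm
  have hB : IsOffDiagonal e B := isOffDiagonal_sub_pinching he A
  have hDs : IsSelfAdjoint D := isSelfAdjoint_pinching (h.isSelfAdjoint hρ.isSelfAdjoint) hA
  have heD (i) : Commute (e i) D := commute_pinching he _ i
  have heρ (i) : Commute (e i) ρ := h.commute_of_commute (.refl ρ) i
  have horth {C : E →L[ℂ] E} (hC : ∀ i, Commute (e i) C) : reTr E (B * C) = 0 :=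
    map_mul_eq_zero_of_isOffDiagonal h.toCompleteOrthogonalIdempotents reTr_mul_comm hB hC
  have hBD : reTr E (B * D * ρ) = 0 := by
    rw [mul_assoc, horth fun i => (heD i).mul_right (heρ i)]
  have hDB : reTr E (D * B * ρ) = 0 := by
    rw [mul_assoc, reTr_mul_comm, mul_assoc, horth fun i => (heρ i).mul_right (heD i)]
  rw [hsum, uncertainty_eq_sqrt_reTr, uncertainty_eq_sqrt_reTr]
  refine Real.sqrt_le_sqrt ?_
  simp only [add_mul, mul_add, map_add, hBD, hDB, horth heρ]
  linarith [sq_reTr_mul_le hρ htr hDs]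

end Trace

section SpectralProjections

/-- The possible eigenvalues of a density operator with spectrum `σ`: zero, indexed by `none`,
and the `λ_j`. -/
def node (σ : Spectrum) : Option (Fin σ.k) → ℝ
  | none => 0
  | some j => σ.eig j

theorem node_injective (σ : Spectrum) : Function.Injective (node σ) := by
  rintro (_ | i) (_ | j) h
  · rfl
  · exact absurd h (σ.eig_pos j).ne
  · exact absurd h (σ.eig_pos i).ne'
  · exact congrArg some (σ.eig_strictAnti.injective h)

variable {H : Type*} [NormedAddCommGroup H] [InnerProductSpace ℂ H]

/-- The spectral projection of `ρ` for the eigenvalue `node σ a`, as a polynomial in `ρ` so that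
it depends smoothly on `ρ`. -/
def spectralProj (σ : Spectrum) (ρ : H →L[ℂ] H) (a : Option (Fin σ.k)) : H →L[ℂ] H :=
  Polynomial.aeval ρ (Lagrange.basis Finset.univ (node σ) a)

variable [FiniteDimensional ℂ H] {σ : Spectrum} {ρ : H →L[ℂ] H}

theorem ext_of_mem_isospectral (h : ρ ∈ isospectral H σ) {S T : H →L[ℂ] H}
    (hST : ∀ a x, ρ x = (node σ a : ℂ) • x → S x = T x) : S = T := by
  have htop : ⨆ μ, Module.End.eigenspace (ρ : H →ₗ[ℂ] H) μ = ⊤ :=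
    Submodule.orthogonal_eq_bot_iff.1 h.1.isSymmetric.orthogonalComplement_iSup_eigenspaces_eq_bot
  have hle : ⨆ μ, Module.End.eigenspace (ρ : H →ₗ[ℂ] H) μ ≤
      LinearMap.eqLocus (S : H →ₗ[ℂ] H) (T : H →ₗ[ℂ] H) := by
    refine iSup_le fun μ x hx => ?_
    have hx' : ρ x = μ • x := Module.End.mem_eigenspace_iff.1 hx
    obtain rfl | hx0 := eq_or_ne x 0
    · exact Submodule.zero_mem _
    obtain rfl | hμ := eq_or_ne μ 0
    · exact hST none x (by simpa only [node, Complex.ofReal_zero] using hx')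
    · obtain ⟨j, rfl⟩ := h.2.2.2 μ hμ (Module.End.hasEigenvalue_of_hasEigenvector ⟨hx, hx0⟩)
      exact hST (some j) x hx'
  ext x
  exact hle (htop ▸ Submodule.mem_top)

theorem isSpectralResolution_spectralProj (h : ρ ∈ isospectral H σ) :
    IsSpectralResolution (spectralProj σ ρ) (node σ) ρ := by
  refine isSpectralResolution_aeval_basis (node_injective σ) ?_
  refine ext_of_mem_isospectral h fun a x hx => ?_
  obtain ⟨q, hq⟩ := Lagrange.X_sub_C_dvd_nodal (node σ) (Finset.mem_univ a)
  have hx' : (ρ - algebraMap ℝ (H →L[ℂ] H) (node σ a)) x = 0 := by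
    rw [sub_apply, hx, Algebra.algebraMap_eq_smul_one]
    simp
  rw [hq, mul_comm, map_mul, map_sub, Polynomial.aeval_X, Polynomial.aeval_C,
    mul_apply_eq_comp, hx', map_zero, zero_apply]

end SpectralProjections

section Purification

theorem exists_unitary_comp_eq {𝕜 E F : Type*} [RCLike 𝕜] [NormedAddCommGroup E]
    [InnerProductSpace 𝕜 E] [NormedAddCommGroup F] [InnerProductSpace 𝕜 F] [CompleteSpace F]
    [FiniteDimensional 𝕜 F] (V W : E →ₗᵢ[𝕜] F) :
    ∃ U : unitary (F →L[𝕜] F),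
      (U : F →L[𝕜] F) ∘L V.toContinuousLinearMap = W.toContinuousLinearMap := by
  let L : LinearMap.range V.toLinearMap →ₗᵢ[𝕜] F := W.comp V.equivRange.symm.toLinearIsometry
  refine ⟨Unitary.linearIsometryEquiv.symm (L.extend.toLinearIsometryEquiv rfl), ?_⟩
  ext x
  have := L.extend_apply (V.equivRange x)
  simpa [L] using this

theorem eigenspace_conj {K M N : Type*} [CommRing K] [AddCommGroup M] [Module K M]
    [AddCommGroup N] [Module K N] (L : M ≃ₗ[K] N) (f : Module.End K M) (μ : K) :
    Module.End.eigenspace (L.conj f) μ = (Module.End.eigenspace f μ).map (L : M →ₗ[K] N) := by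
  ext y
  rw [Submodule.mem_map_equiv, Module.End.mem_eigenspace_iff, Module.End.mem_eigenspace_iff,
    LinearEquiv.conj_apply_apply, ← L.injective.eq_iff (a := f _), map_smul, L.apply_symm_apply]

variable {H : Type*} [NormedAddCommGroup H] [InnerProductSpace ℂ H] {σ : Spectrum}
  {ρ : H →L[ℂ] H}

theorem conj_mem_isospectral [CompleteSpace H] (h : ρ ∈ isospectral H σ)
    (U : unitary (H →L[ℂ] H)) :
    (U : H →L[ℂ] H) * ρ * star (U : H →L[ℂ] H) ∈ isospectral H σ := by
  let L : H ≃ₗ[ℂ] H := (Unitary.linearIsometryEquiv U).toLinearEquiv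
  have hconj : (((U : H →L[ℂ] H) * ρ * star (U : H →L[ℂ] H) : H →L[ℂ] H) : H →ₗ[ℂ] H) =
      L.conj (ρ : H →ₗ[ℂ] H) := by
    ext x; rfl
  refine ⟨mul_assoc (U : H →L[ℂ] H) ρ _ ▸ h.1.conj_adjoint (U : H →L[ℂ] H), ?_, fun j => ?_,
    fun μ hμ hev => h.2.2.2 μ hμ ?_⟩
  · rw [tr, hconj, LinearMap.trace_conj']
    exact h.2.1
  · rw [hconj, eigenspace_conj, LinearEquiv.finrank_map_eq, h.2.2.1]
  · rw [hconj, Module.End.hasEigenvalue_iff, eigenspace_conj] at hev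
    exact Module.End.hasEigenvalue_iff.2 fun hbot => hev (by rw [hbot, Submodule.map_bot])

theorem exists_orthonormal_span_eq_eigenspace [FiniteDimensional ℂ H] (h : ρ ∈ isospectral H σ) :
    ∃ v : (Σ j, Fin (σ.mult j)) → H, Orthonormal ℂ v ∧ ∀ j,
      Submodule.span ℂ (Set.range fun i => v ⟨j, i⟩) =
        Module.End.eigenspace (ρ : H →ₗ[ℂ] H) (σ.eig j : ℂ) := by
  let b (j : Fin σ.k) : OrthonormalBasis (Fin (σ.mult j)) ℂ
      (Module.End.eigenspace (ρ : H →ₗ[ℂ] H) (σ.eig j : ℂ)) :=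
    (stdOrthonormalBasis ℂ _).reindex (finCongr (h.2.2.1 j))
  have hinj : Function.Injective fun j => (σ.eig j : ℂ) :=
    Complex.ofReal_injective.comp σ.eig_strictAnti.injective
  refine ⟨fun a => b a.1 a.2,
    (h.1.isSymmetric.orthogonalFamily_eigenspaces.comp hinj).orthonormal_sigma_orthonormal
      fun j => (b j).orthonormal, fun j => ?_⟩
  have hspan : Submodule.span ℂ (Set.range (b j)) = ⊤ := by
    simpa using (b j).toBasis.span_eq
  have := congrArg (Submodule.map (Submodule.subtype _)) hspan
  rwa [Submodule.map_span, ← Set.range_comp, Submodule.map_subtype_top] at this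

theorem exists_isometry_intertwining_specOp [FiniteDimensional ℂ H] (h : ρ ∈ isospectral H σ) :
    ∃ V : Aux σ →ₗᵢ[ℂ] H,
      ρ ∘L V.toContinuousLinearMap = V.toContinuousLinearMap ∘L specOp σ ∧
      ∀ j, Module.End.eigenspace (ρ : H →ₗ[ℂ] H) (σ.eig j : ℂ) ≤
        LinearMap.range V.toLinearMap := by
  obtain ⟨v, hv, hspan⟩ := exists_orthonormal_span_eq_eigenspace h
  let e := (EuclideanSpace.basisFun (Σ j, Fin (σ.mult j)) ℂ).toBasis
  have hconstr (a) : e.constr ℂ v (e a) = v a := e.constr_basis ℂ v a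
  let V : Aux σ →ₗᵢ[ℂ] H := (e.constr ℂ v).isometryOfOrthonormal (v := e)
    (by simpa only [e, OrthonormalBasis.coe_toBasis] using OrthonormalBasis.orthonormal _)
    (by rwa [show ⇑(e.constr ℂ v) ∘ ⇑e = v from funext hconstr])
  refine ⟨V, ContinuousLinearMap.coe_injective (e.ext fun a => ?_), fun j => ?_⟩
  · have hPe : specOp σ (e a) = (σ.eig a.1 : ℂ) • e a := by
      ext c
      rw [specOp_apply]
      by_cases hc : c = a <;> simp [e, hc]
    have hρv : ρ (v a) = (σ.eig a.1 : ℂ) • v a := Module.End.mem_eigenspace_iff.1 <|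
      hspan a.1 ▸ Submodule.subset_span ⟨a.2, rfl⟩
    change ρ (V (e a)) = V (specOp σ (e a))
    rw [hPe, map_smul, show V (e a) = v a from hconstr a, hρv]
  · rw [← hspan, Submodule.span_le]
    rintro _ ⟨i, rfl⟩
    exact ⟨e ⟨j, i⟩, hconstr _⟩

theorem exists_isometry_conj_specOp_eq [CompleteSpace H] [FiniteDimensional ℂ H]
    (h : ρ ∈ isospectral H σ) : ∃ V : Aux σ →ₗᵢ[ℂ] H,
      V.toContinuousLinearMap ∘L specOp σ ∘L (V.toContinuousLinearMap†) = ρ := by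
  obtain ⟨V, hcomm, hle⟩ := exists_isometry_intertwining_specOp h
  have hrange : V.toContinuousLinearMap ∘L (V.toContinuousLinearMap†) ∘L ρ = ρ := by
    refine ext_of_mem_isospectral h fun a x hx => ?_
    rcases a with _ | j
    · have hx0 : ρ x = 0 := by simpa [node] using hx
      simp [hx0]
    · obtain ⟨y, rfl⟩ := hle j (Module.End.mem_eigenspace_iff.2 hx)
      have hy : (V.toContinuousLinearMap†) (V y) = y :=
        DFunLike.congr_fun V.adjoint_comp_self y
      have hx' : ρ (V y) = (σ.eig j : ℂ) • V y := hx
      change V ((V.toContinuousLinearMap†) (ρ (V y))) = ρ (V y)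
      rw [hx', map_smul, hy, map_smul]
  refine ⟨V, ?_⟩
  rw [← ContinuousLinearMap.comp_assoc, ← hcomm]
  have hadj := congrArg ContinuousLinearMap.adjoint hrange
  rwa [ContinuousLinearMap.adjoint_comp, ContinuousLinearMap.adjoint_comp,
    ContinuousLinearMap.adjoint_adjoint, h.1.isSelfAdjoint.adjoint_eq] at hadj

theorem exists_purification [CompleteSpace H] [FiniteDimensional ℂ H] (h : ρ ∈ isospectral H σ) :
    ∃ ψ ∈ purifications H σ, proj ψ = ρ := by
  obtain ⟨V, hVρ⟩ := exists_isometry_conj_specOp_eq h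
  have hV (B : Aux σ →L[ℂ] Aux σ) :
      (V.toContinuousLinearMap†) ∘L V.toContinuousLinearMap ∘L B = B := by
    rw [← ContinuousLinearMap.comp_assoc, V.adjoint_comp_self]
    rfl
  have hP : 0 ≤ specOp σ := by
    have hconj := h.1.adjoint_conj V.toContinuousLinearMap
    rw [← hVρ, ContinuousLinearMap.comp_assoc, ContinuousLinearMap.comp_assoc, V.adjoint_comp_self,
      hV] at hconj
    exact (ContinuousLinearMap.nonneg_iff_isPositive _).2 hconj
  let S := CFC.sqrt (specOp σ)
  have hSS : S ∘L S = specOp σ := CFC.sqrt_mul_sqrt_self _ hP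
  have hS : S† = S := (CFC.sqrt_nonneg (specOp σ)).isSelfAdjoint
  refine ⟨V.toContinuousLinearMap ∘L S, ?_, ?_⟩
  · change _ ∘L _ = _
    rw [ContinuousLinearMap.adjoint_comp, ContinuousLinearMap.comp_assoc, hV, hS, hSS]
  · rw [proj, ContinuousLinearMap.adjoint_comp, hS, ContinuousLinearMap.comp_assoc,
      ← ContinuousLinearMap.comp_assoc S, hSS, hVρ]

theorem exists_unitary_conj_eq [CompleteSpace H] [FiniteDimensional ℂ H] {ρ₀ ρ₁ : H →L[ℂ] H}
    (h₀ : ρ₀ ∈ isospectral H σ) (h₁ : ρ₁ ∈ isospectral H σ) :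
    ∃ U : unitary (H →L[ℂ] H), (U : H →L[ℂ] H) * ρ₀ * star (U : H →L[ℂ] H) = ρ₁ := by
  obtain ⟨V, rfl⟩ := exists_isometry_conj_specOp_eq h₀
  obtain ⟨W, rfl⟩ := exists_isometry_conj_specOp_eq h₁
  obtain ⟨U, hU⟩ := exists_unitary_comp_eq V W
  refine ⟨U, ?_⟩
  rw [← hU, ContinuousLinearMap.adjoint_comp]
  rfl

end Purification

section Horizontal

variable {H : Type*} [NormedAddCommGroup H] [InnerProductSpace ℂ H] {σ : Spectrum}
  {ψ Y : Aux σ →L[ℂ] H} {A B ρ : H →L[ℂ] H}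

theorem hamLift_eq_comp (ħ : ℝ) (A : H →L[ℂ] H) (ψ : Aux σ →L[ℂ] H) :
    hamLift ħ A ψ = ((1 / (Complex.I * ħ)) • A) ∘L ψ := rfl

theorem hamField_eq (ħ : ℝ) (A ρ : H →L[ℂ] H) :
    hamField ħ A ρ = ((1 / (Complex.I * ħ)) • A) * ρ - ρ * ((1 / (Complex.I * ħ)) • A) := by
  rw [smul_mul_assoc, mul_smul_comm, ← smul_sub]
  rfl

theorem hamField_sub_of_commute (ħ : ℝ) {D : H →L[ℂ] H} (hD : Commute ρ D) :
    hamField ħ (A - D) ρ = hamField ħ A ρ := by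
  rw [hamField, hamField, ContinuousLinearMap.sub_comp, ContinuousLinearMap.comp_sub,
    show D ∘L ρ = ρ ∘L D from hD.eq.symm, sub_sub_sub_cancel_right]

variable [CompleteSpace H]

theorem skewAdjoint_comp_mem_tangent (hB : star B = -B) (ψ : Aux σ →L[ℂ] H) :
    B ∘L ψ ∈ tangent ψ := by
  change _ + _ = _
  rw [ContinuousLinearMap.adjoint_comp, ← ContinuousLinearMap.star_eq_adjoint B, hB,
    ContinuousLinearMap.comp_neg, ContinuousLinearMap.neg_comp, ContinuousLinearMap.comp_assoc,
    neg_add_cancel]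

theorem dproj_skewAdjoint_comp (hB : star B = -B) (ψ : Aux σ →L[ℂ] H) :
    dproj ψ (B ∘L ψ) = B * proj ψ - proj ψ * B := by
  rw [dproj, ContinuousLinearMap.adjoint_comp, ← ContinuousLinearMap.star_eq_adjoint B, hB,
    ContinuousLinearMap.comp_neg, ContinuousLinearMap.comp_neg, ← sub_eq_add_neg]
  rfl

theorem commute_proj_comp_adjoint (hY : Y ∈ vertical ψ) : Commute (proj ψ) (Y ∘L (ψ†)) := by
  have htangent : Y† ∘L ψ = -(ψ† ∘L Y) := eq_neg_of_add_eq_zero_left hY.1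
  have hdproj : Y ∘L ψ† = -(ψ ∘L Y†) := eq_neg_of_add_eq_zero_left hY.2
  symm
  calc (Y ∘L ψ†) ∘L (ψ ∘L ψ†) = -(ψ ∘L (Y† ∘L ψ) ∘L ψ†) := by
        rw [hdproj, ContinuousLinearMap.neg_comp]
        rfl
    _ = (ψ ∘L ψ†) ∘L (Y ∘L ψ†) := by
        rw [htangent, ContinuousLinearMap.neg_comp, ContinuousLinearMap.comp_neg, neg_neg]
        rfl

theorem I_smul_mem_vertical (ψ : Aux σ →L[ℂ] H) : Complex.I • ψ ∈ vertical ψ := by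
  constructor
  · change _ + _ = _
    rw [map_smulₛₗ]
    simp
  · rw [dproj, map_smulₛₗ]
    simp

theorem star_one_div_I_mul_smul (ħ : ℝ) (hA : IsSelfAdjoint A) :
    star ((1 / (Complex.I * ħ)) • A) = -((1 / (Complex.I * ħ)) • A) := by
  rw [star_smul, hA.star_eq, ← neg_smul]
  congr 1
  simp

theorem dproj_hamLift (ħ : ℝ) (hA : IsSelfAdjoint A) (ψ : Aux σ →L[ℂ] H) :
    dproj ψ (hamLift ħ A ψ) = hamField ħ A (proj ψ) := by
  rw [hamLift_eq_comp, dproj_skewAdjoint_comp (star_one_div_I_mul_smul ħ hA), hamField_eq]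

theorem hsMetric_eq (c : ℝ) (X Y : Aux σ →L[ℂ] H) :
    hsMetric c X Y = c * reTr (Aux σ) (X† ∘L Y) := by
  have hadj : reTr (Aux σ) (Y† ∘L X) = reTr (Aux σ) (X† ∘L Y) := by
    rw [← reTr_adjoint, ContinuousLinearMap.adjoint_comp, ContinuousLinearMap.adjoint_adjoint]
  rw [hsMetric, ← reTr_apply, map_add, hadj]
  ring

variable [FiniteDimensional ℂ H]

theorem hsMetric_skewAdjoint_comp (c : ℝ) (hB : star B = -B) (ψ Y : Aux σ →L[ℂ] H) :
    hsMetric c (B ∘L ψ) Y = -(c * reTr H (B * (Y ∘L (ψ†)))) := by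
  rw [hsMetric_eq, ContinuousLinearMap.adjoint_comp, ← ContinuousLinearMap.star_eq_adjoint B, hB,
    ContinuousLinearMap.comp_neg, ContinuousLinearMap.neg_comp, map_neg, mul_neg,
    ContinuousLinearMap.comp_assoc, reTr_comp_comm]
  rfl

theorem skewAdjoint_comp_mem_horizontal (c : ℝ) {ι : Type*} [Fintype ι]
    {e : ι → H →L[ℂ] H} {μ : ι → ℝ} (h : IsSpectralResolution e μ (proj ψ)) (hB : star B = -B)
    (hoff : IsOffDiagonal e B) : B ∘L ψ ∈ horizontal c ψ := by
  refine ⟨skewAdjoint_comp_mem_tangent hB ψ, fun Y hY => ?_⟩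
  have htr : reTr H (B * (Y ∘L (ψ†))) = 0 :=
    map_mul_eq_zero_of_isOffDiagonal h.toCompleteOrthogonalIdempotents reTr_mul_comm hoff
      (h.commute_of_commute (commute_proj_comp_adjoint hY))
  rw [hsMetric_skewAdjoint_comp c hB, htr, mul_zero, neg_zero]

theorem hsMetric_hamLift_self (c ħ : ℝ) (hA : IsSelfAdjoint A) (ψ : Aux σ →L[ℂ] H) :
    hsMetric c (hamLift ħ A ψ) (hamLift ħ A ψ) = c / ħ ^ 2 * reTr H (A * A * proj ψ) := by
  have hsq : (1 / (Complex.I * ħ)) • A * ((hamLift ħ A ψ) ∘L (ψ†)) =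
      (-(ħ ^ 2)⁻¹ : ℝ) • (A * A * proj ψ) := by
    rw [hamLift, ContinuousLinearMap.smul_comp, smul_mul_smul_comm, ContinuousLinearMap.comp_assoc,
      ← Complex.coe_smul]
    congr 1
    push_cast
    rw [div_mul_div_comm, mul_mul_mul_comm, Complex.I_mul_I]
    field_simp
  conv_lhs => arg 2; rw [hamLift_eq_comp]
  rw [hsMetric_skewAdjoint_comp c (star_one_div_I_mul_smul ħ hA), hsq, map_smul, smul_eq_mul]
  ring

theorem reTr_mul_proj_eq_zero {c ħ : ℝ} (hc : c ≠ 0) (hħ : ħ ≠ 0) (hA : IsSelfAdjoint A)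
    (h : hamLift ħ A ψ ∈ horizontal c ψ) : reTr H (A * proj ψ) = 0 := by
  have horth := h.2 _ (I_smul_mem_vertical ψ)
  have hphase : (1 / (Complex.I * ħ)) • A * ((Complex.I • ψ) ∘L (ψ†)) =
      (ħ⁻¹ : ℝ) • (A * proj ψ) := by
    rw [ContinuousLinearMap.smul_comp, smul_mul_smul_comm, ← Complex.coe_smul]
    congr 1
    push_cast
    field_simp
  rw [hamLift_eq_comp, hsMetric_skewAdjoint_comp c (star_one_div_I_mul_smul ħ hA), hphase,
    map_smul] at horth
  simpa [hc, hħ] using horth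

theorem sqrt_metric_of_horizontal {c ħ : ℝ} (hc : 0 < c) (hħ : 0 < ħ) (hA : IsSelfAdjoint A)
    (hψ : ψ ∈ purifications H σ) (h : hamLift ħ A ψ ∈ horizontal c ψ) :
    √(metric c σ (proj ψ) (hamField ħ A (proj ψ)) (hamField ħ A (proj ψ))) =
      √c * (1 / ħ * uncertainty A (proj ψ)) := by
  rw [← dproj_hamLift ħ hA, metric_dproj hc hψ h h, hsMetric_hamLift_self c ħ hA,
    uncertainty_eq_sqrt_reTr, reTr_mul_proj_eq_zero hc.ne' hħ.ne' hA h,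
    Real.sqrt_mul (by positivity), Real.sqrt_div hc.le, Real.sqrt_sq hħ.le]
  simp only [ne_eq, OfNat.ofNat_ne_zero, not_false_eq_true, zero_pow, sub_zero]
  ring

theorem sqrt_metric_of_isOffDiagonal {c ħ : ℝ} (hc : 0 < c) (hħ : 0 < ħ)
    (hρ : ρ ∈ isospectral H σ) (hA : IsSelfAdjoint A)
    (hoff : IsOffDiagonal (spectralProj σ ρ) A) :
    √(metric c σ ρ (hamField ħ A ρ) (hamField ħ A ρ)) = √c * (1 / ħ * uncertainty A ρ) := by
  obtain ⟨ψ, hψ, rfl⟩ := exists_purification hρ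
  refine sqrt_metric_of_horizontal hc hħ hA hψ ?_
  rw [hamLift_eq_comp]
  exact skewAdjoint_comp_mem_horizontal c (isSpectralResolution_spectralProj hρ)
    (star_one_div_I_mul_smul ħ hA) (hoff.smul _)

theorem sqrt_metric_le {c ħ : ℝ} (hc : 0 < c) (hħ : 0 < ħ) (hρ : ρ ∈ isospectral H σ)
    (hA : IsSelfAdjoint A) :
    √(metric c σ ρ (hamField ħ A ρ) (hamField ħ A ρ)) ≤ √c * (1 / ħ * uncertainty A ρ) := by
  have h := isSpectralResolution_spectralProj hρ
  rw [← hamField_sub_of_commute ħ (h.commute_pinching A),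
    sqrt_metric_of_isOffDiagonal hc hħ hρ
      (hA.sub (isSelfAdjoint_pinching (h.isSelfAdjoint hρ.1.isSelfAdjoint) hA))
      (isOffDiagonal_sub_pinching h.toOrthogonalIdempotents A)]
  gcongr
  exact uncertainty_sub_pinching_le hρ.1 (congrArg Complex.re hρ.2.1) h hA

end Horizontal

section Calculus

theorem expUnitary_argSelfAdjoint_of_finite_spectrum {A : Type*} [CStarAlgebra A] (u : unitary A)
    (hu : (spectrum ℂ (u : A)).Finite) :
    selfAdjoint.expUnitary (Unitary.argSelfAdjoint u) = u := by
  ext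
  -- `arg` jumps at `-1`, but every function is continuous on a finite set.
  have harg : ContinuousOn Complex.arg (spectrum ℂ (u : A)) := hu.continuousOn _
  rw [selfAdjoint.expUnitary_coe, Unitary.argSelfAdjoint_coe,
    ← CFC.exp_eq_normedSpace_exp (𝕜 := ℂ), ← cfc_comp_smul .., ← cfc_comp' ..]
  conv_rhs => rw [← cfc_id' ℂ (u : A)]
  refine cfc_congr fun z hz => ?_
  have hnorm : ‖z‖ = 1 := spectrum.norm_eq_one_of_unitary u.2 hz
  have hlog : Complex.I * z.arg = Complex.log z :=
    Complex.ext (by simp [Complex.log_re, hnorm]) (by simp [Complex.log_im])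
  have hz0 : z ≠ 0 := norm_ne_zero_iff.1 (hnorm ▸ one_ne_zero)
  simpa [← Complex.exp_eq_exp_ℂ, hlog] using Complex.exp_log hz0

theorem finite_spectrum {𝕜 E : Type*} [NontriviallyNormedField 𝕜] [CompleteSpace 𝕜]
    [NormedAddCommGroup E] [NormedSpace 𝕜 E] [FiniteDimensional 𝕜 E] (T : E →L[𝕜] E) :
    (spectrum 𝕜 T).Finite :=
  AlgEquiv.spectrum_eq (Module.End.toContinuousLinearMap (𝕜 := 𝕜) E) (T : E →ₗ[𝕜] E) ▸
    Module.End.finite_spectrum (K := 𝕜) (T : E →ₗ[𝕜] E)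

theorem hasDerivAt_exp_smul_mul_mul_star {A : Type*} [NormedRing A] [NormedAlgebra ℝ A]
    [CompleteSpace A] [StarRing A] [ContinuousStar A] [StarModule ℝ A] {x : A}
    (hx : star x = -x) (a : A) (t : ℝ) :
    HasDerivAt (fun s : ℝ => NormedSpace.exp (s • x) * a * star (NormedSpace.exp (s • x)))
      (x * (NormedSpace.exp (t • x) * a * star (NormedSpace.exp (t • x))) -
        NormedSpace.exp (t • x) * a * star (NormedSpace.exp (t • x)) * x) t := by
  have hexp := hasDerivAt_exp_smul_const' x t
  have hstar := hexp.star
  rw [star_mul, hx] at hstar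
  refine ((hexp.mul_const a).mul hstar).congr_deriv ?_
  noncomm_ring

theorem mul_deriv_mul_eq_zero {A : Type*} [NormedRing A] [NormedAlgebra ℝ A] {γ e : ℝ → A}
    {γ' e' : A} {s : Set ℝ} {t μ : ℝ} (hs : UniqueDiffWithinAt ℝ s t) (ht : t ∈ s)
    (hγ : HasDerivWithinAt γ γ' s t) (he : HasDerivWithinAt e e' s t)
    (hγe : ∀ u ∈ s, γ u * e u = μ • e u) (heγ : e t * γ t = μ • e t) :
    e t * γ' * e t = 0 := by
  have hderiv : γ' * e t + γ t * e' = μ • e' :=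
    hs.eq_deriv _ (hγ.fun_mul he) ((he.const_smul μ).congr hγe (hγe t ht))
  have := congrArg (e t * ·) hderiv
  simpa only [mul_add, ← mul_assoc, heγ, mul_smul_comm, smul_mul_assoc, add_eq_right] using this

theorem differentiableWithinAt_aeval {A : Type*} [NormedRing A] [NormedAlgebra ℝ A] {γ : ℝ → A}
    {s : Set ℝ} {t : ℝ} (h : DifferentiableWithinAt ℝ γ s t) (p : Polynomial ℝ) :
    DifferentiableWithinAt ℝ (fun u => Polynomial.aeval (γ u) p) s t := by
  simp only [Polynomial.aeval_eq_sum_range]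
  exact DifferentiableWithinAt.fun_sum fun i _ => (h.fun_pow i).const_smul (p.coeff i)

end Calculus

section VonNeumann

variable {H : Type*} [NormedAddCommGroup H] [InnerProductSpace ℂ H] {σ : Spectrum}
  {ρ₀ ρ₁ : H →L[ℂ] H} {A ρ γ : ℝ → H →L[ℂ] H} {c ħ T τ t : ℝ}

theorem hamField_I_mul_smul (hħ : ħ ≠ 0) (x ρ : H →L[ℂ] H) :
    hamField ħ ((Complex.I * ħ) • x) ρ = x * ρ - ρ * x := by
  have hne : Complex.I * ħ ≠ 0 := mul_ne_zero Complex.I_ne_zero (Complex.ofReal_ne_zero.2 hħ)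
  rw [hamField_eq, smul_smul, one_div_mul_cancel hne, one_smul]

theorem mul_energyIntegral (r ħ τ : ℝ) (A ρ : ℝ → H →L[ℂ] H) :
    r * energyIntegral ħ τ A ρ = ∫ t in (0 : ℝ)..τ, r * (1 / ħ * uncertainty (A t) (ρ t)) := by
  rw [energyIntegral, ← intervalIntegral.integral_const_mul, ← intervalIntegral.integral_const_mul]

theorem energyIntegral_rescale [FiniteDimensional ℂ H] (ħ : ℝ) (hT : 0 ≤ T) (hτ : 0 < τ)
    (A ρ : ℝ → H →L[ℂ] H) :
    energyIntegral ħ τ (fun t => (T / τ) • A (T / τ * t)) (fun t => ρ (T / τ * t)) =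
      energyIntegral ħ T A ρ := by
  simp only [energyIntegral, uncertainty_smul (div_nonneg hT hτ.le)]
  rw [intervalIntegral.integral_const_mul,
    intervalIntegral.mul_integral_comp_mul_left (f := fun t => uncertainty (A t) (ρ t)), mul_zero,
    div_mul_cancel₀ _ hτ.ne']

variable [CompleteSpace H]

theorem isSelfAdjoint_I_mul_smul (ħ : ℝ) {x : H →L[ℂ] H} (hx : star x = -x) :
    IsSelfAdjoint ((Complex.I * ħ) • x) := by
  rw [isSelfAdjoint_iff, star_smul, hx]
  simp

theorem length_nonneg (c : ℝ) (σ : Spectrum) (hT : 0 ≤ T) (γ : ℝ → H →L[ℂ] H) :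
    0 ≤ length c σ T γ :=
  intervalIntegral.integral_nonneg hT fun _ _ => Real.sqrt_nonneg _

theorem geodesicDist_le_length (h : IsCurve σ T ρ₀ ρ₁ γ) (hT : 0 < T) (c : ℝ) :
    geodesicDist c σ ρ₀ ρ₁ ≤ length c σ T γ := by
  refine csInf_le ⟨0, ?_⟩ ⟨T, hT, γ, h, rfl⟩
  rintro _ ⟨T', hT', γ', -, rfl⟩
  exact length_nonneg c σ hT'.le γ'

theorem IsCurve.isSelfAdjoint_derivWithin (h : IsCurve σ T ρ₀ ρ₁ γ) (ht : t ∈ Set.Icc 0 T) :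
    IsSelfAdjoint (derivWithin γ (Set.Icc 0 T) t) := by
  have hγ (u) (hu : u ∈ Set.Icc 0 T) : star (γ u) = γ u := (h.mem u hu).1.isSelfAdjoint
  rw [isSelfAdjoint_iff, ← derivWithin.star]
  exact derivWithin_congr hγ (hγ t ht)

theorem exists_isVonNeumann [FiniteDimensional ℂ H] (h₀ : ρ₀ ∈ isospectral H σ)
    (h₁ : ρ₁ ∈ isospectral H σ) (hħ : ħ ≠ 0) (hτ : τ ≠ 0) :
    ∃ A ρ : ℝ → H →L[ℂ] H, IsVonNeumann ħ σ τ ρ₀ ρ₁ A ρ := by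
  obtain ⟨U, hU⟩ := exists_unitary_conj_eq h₀ h₁
  let K := Unitary.argSelfAdjoint U
  let x : H →L[ℂ] H := τ⁻¹ • Complex.I • (K : H →L[ℂ] H)
  have hx : star x = -x := by simp [x, (K.2 : IsSelfAdjoint (K : H →L[ℂ] H)).star_eq]
  have hunitary (t : ℝ) : NormedSpace.exp (t • x) ∈ unitary (H →L[ℂ] H) :=
    let +nondep : NormedAlgebra ℚ (H →L[ℂ] H) := .restrictScalars ℚ ℂ _
    NormedSpace.exp_mem_unitary_of_mem_skewAdjoint (skewAdjoint.smul_mem t hx)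
  have hU' : NormedSpace.exp (τ • x) = (U : H →L[ℂ] H) := by
    rw [smul_inv_smul₀ hτ, ← selfAdjoint.expUnitary_coe,
      expUnitary_argSelfAdjoint_of_finite_spectrum U (finite_spectrum _)]
  refine ⟨fun _ => (Complex.I * ħ) • x,
    fun t => NormedSpace.exp (t • x) * ρ₀ * star (NormedSpace.exp (t • x)),
    fun _ _ => isSelfAdjoint_I_mul_smul ħ hx, continuousOn_const,
    fun t _ => conj_mem_isospectral h₀ ⟨_, hunitary t⟩, fun t _ => ?_, by simp, hU'.symm ▸ hU⟩
  rw [hamField_I_mul_smul hħ]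
  exact (hasDerivAt_exp_smul_mul_mul_star hx ρ₀ t).hasDerivWithinAt

namespace IsVonNeumann

theorem continuousOn_hamField (h : IsVonNeumann ħ σ τ ρ₀ ρ₁ A ρ) :
    ContinuousOn (fun t => hamField ħ (A t) (ρ t)) (Set.Icc 0 τ) := by
  have hρ : ContinuousOn ρ (Set.Icc 0 τ) := fun t ht => (h.eqn t ht).continuousWithinAt
  exact ((h.continuousOn.mul hρ).sub (hρ.mul h.continuousOn)).const_smul
    (1 / (Complex.I * (ħ : ℂ)))

theorem derivWithin_eq (h : IsVonNeumann ħ σ τ ρ₀ ρ₁ A ρ) (hτ : 0 < τ) (ht : t ∈ Set.Icc 0 τ) :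
    derivWithin ρ (Set.Icc 0 τ) t = hamField ħ (A t) (ρ t) :=
  (h.eqn t ht).derivWithin (uniqueDiffOn_Icc hτ t ht)

theorem isCurve (h : IsVonNeumann ħ σ τ ρ₀ ρ₁ A ρ) (hτ : 0 < τ) : IsCurve σ τ ρ₀ ρ₁ ρ where
  contDiffOn := (contDiffOn_one_iff_derivWithin (uniqueDiffOn_Icc hτ)).2
    ⟨fun t ht => (h.eqn t ht).differentiableWithinAt,
      h.continuousOn_hamField.congr fun _ ht => h.derivWithin_eq hτ ht⟩
  mem := h.mem
  left := h.left
  right := h.right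

theorem continuousOn_uncertainty [FiniteDimensional ℂ H] (h : IsVonNeumann ħ σ τ ρ₀ ρ₁ A ρ) :
    ContinuousOn (fun t => uncertainty (A t) (ρ t)) (Set.Icc 0 τ) := by
  have hρ : ContinuousOn ρ (Set.Icc 0 τ) := fun t ht => (h.eqn t ht).continuousWithinAt
  have hA := h.continuousOn
  simp only [uncertainty_eq_sqrt_reTr]
  fun_prop

theorem length_eq_of_sqrt_metric_eq (h : IsVonNeumann ħ σ τ ρ₀ ρ₁ A ρ) (hτ : 0 < τ)
    (hmetric : ∀ t ∈ Set.Icc 0 τ,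
      √(metric c σ (ρ t) (hamField ħ (A t) (ρ t)) (hamField ħ (A t) (ρ t))) =
        √c * (1 / ħ * uncertainty (A t) (ρ t))) :
    length c σ τ ρ = √c * energyIntegral ħ τ A ρ := by
  rw [mul_energyIntegral, length]
  refine intervalIntegral.integral_congr fun t ht => ?_
  rw [Set.uIcc_of_le hτ.le] at ht
  simpa only [h.derivWithin_eq hτ ht] using hmetric t ht

theorem length_eq_of_horizontal [FiniteDimensional ℂ H] (h : IsVonNeumann ħ σ τ ρ₀ ρ₁ A ρ)
    (hc : 0 < c) (hħ : 0 < ħ) (hτ : 0 < τ) (hlift : GeneratesHorizontalLift c ħ σ τ A ρ) :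
    length c σ τ ρ = √c * energyIntegral ħ τ A ρ := by
  obtain ⟨ψ, hψ⟩ := hlift
  refine h.length_eq_of_sqrt_metric_eq hτ fun t ht => ?_
  obtain ⟨hmem, hproj, -, hhor⟩ := hψ t ht
  rw [← hproj]
  exact sqrt_metric_of_horizontal hc hħ (h.selfAdjoint t ht) hmem hhor

theorem length_le [FiniteDimensional ℂ H] (h : IsVonNeumann ħ σ τ ρ₀ ρ₁ A ρ) (hc : 0 < c)
    (hħ : 0 < ħ) (hτ : 0 < τ) : length c σ τ ρ ≤ √c * energyIntegral ħ τ A ρ := by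
  have hint : IntervalIntegrable (fun t => √c * (1 / ħ * uncertainty (A t) (ρ t)))
      MeasureTheory.volume 0 τ := by
    refine ContinuousOn.intervalIntegrable ?_
    rw [Set.uIcc_of_le hτ.le]
    exact (h.continuousOn_uncertainty.const_smul (1 / ħ)).const_smul (√c)
  rw [mul_energyIntegral, length, intervalIntegral.integral_of_le hτ.le,
    intervalIntegral.integral_of_le hτ.le]
  refine MeasureTheory.integral_mono_of_nonneg (.of_forall fun t => Real.sqrt_nonneg _) hint.1 ?_
  refine (MeasureTheory.ae_restrict_iff' measurableSet_Ioc).2 (.of_forall fun t ht => ?_)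
  have ht' : t ∈ Set.Icc 0 τ := Set.Ioc_subset_Icc_self ht
  simpa only [h.derivWithin_eq hτ ht'] using
    sqrt_metric_le hc hħ (h.mem t ht') (h.selfAdjoint t ht')

theorem rescale (h : IsVonNeumann ħ σ T ρ₀ ρ₁ A ρ) (hT : 0 < T) (hτ : 0 < τ) :
    IsVonNeumann ħ σ τ ρ₀ ρ₁ (fun t => (T / τ) • A (T / τ * t)) (fun t => ρ (T / τ * t)) := by
  have hmaps : Set.MapsTo (fun t => T / τ * t) (Set.Icc 0 τ) (Set.Icc 0 T) := fun t ht =>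
    ⟨mul_nonneg (by positivity) ht.1, by
      simpa [div_mul_cancel₀ _ hτ.ne'] using
        mul_le_mul_of_nonneg_left ht.2 (by positivity : 0 ≤ T / τ)⟩
  refine ⟨fun t ht => IsSelfAdjoint.smul (.all _) (h.selfAdjoint _ (hmaps ht)),
    (h.continuousOn.comp (by fun_prop) hmaps).const_smul (T / τ),
    fun t ht => h.mem _ (hmaps ht), fun t ht => ?_, ?_, ?_⟩
  · have hd : HasDerivWithinAt (fun t => T / τ * t) (T / τ) (Set.Icc 0 τ) t := by
      simpa using (hasDerivWithinAt_id t (Set.Icc 0 τ)).const_mul (T / τ)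
    refine ((h.eqn _ (hmaps ht)).scomp t hd hmaps).congr_deriv ?_
    rw [hamField, hamField, ContinuousLinearMap.smul_comp, ContinuousLinearMap.comp_smul,
      ← smul_sub, smul_comm]
  · simpa using h.left
  · simpa [div_mul_cancel₀ _ hτ.ne'] using h.right

end IsVonNeumann

end VonNeumann

section Curves

variable {H : Type*} [NormedAddCommGroup H] [InnerProductSpace ℂ H]

/-- The Hamiltonian without diagonal blocks that moves `ρ` with velocity `v`. -/
def horizontalHamiltonian (ħ : ℝ) (σ : Spectrum) (ρ v : H →L[ℂ] H) : H →L[ℂ] H :=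
  (Complex.I * ħ) • commutatorInv (spectralProj σ ρ) (node σ) v

variable [FiniteDimensional ℂ H] {σ : Spectrum}

theorem isOffDiagonal_horizontalHamiltonian (ħ : ℝ) {ρ : H →L[ℂ] H} (hρ : ρ ∈ isospectral H σ)
    (v : H →L[ℂ] H) : IsOffDiagonal (spectralProj σ ρ) (horizontalHamiltonian ħ σ ρ v) :=
  (isOffDiagonal_commutatorInv (isSpectralResolution_spectralProj hρ).toOrthogonalIdempotents
    _ v).smul _

theorem hamField_horizontalHamiltonian {ħ : ℝ} (hħ : ħ ≠ 0) {ρ v : H →L[ℂ] H}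
    (hρ : ρ ∈ isospectral H σ) (hv : IsOffDiagonal (spectralProj σ ρ) v) :
    hamField ħ (horizontalHamiltonian ħ σ ρ v) ρ = v := by
  rw [horizontalHamiltonian, hamField_I_mul_smul hħ,
    (isSpectralResolution_spectralProj hρ).commutatorInv_mul_sub_mul hv]

variable [CompleteSpace H]

theorem isSelfAdjoint_horizontalHamiltonian (ħ : ℝ) {ρ v : H →L[ℂ] H}
    (hρ : ρ ∈ isospectral H σ) (hv : IsSelfAdjoint v) :
    IsSelfAdjoint (horizontalHamiltonian ħ σ ρ v) :=
  isSelfAdjoint_I_mul_smul ħ <| star_commutatorInv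
    ((isSpectralResolution_spectralProj hρ).isSelfAdjoint hρ.1.isSelfAdjoint) _ hv

variable {ρ₀ ρ₁ : H →L[ℂ] H} {γ : ℝ → H →L[ℂ] H} {c ħ T τ t : ℝ}

namespace IsCurve

theorem isOffDiagonal_derivWithin (h : IsCurve σ T ρ₀ ρ₁ γ) (hT : 0 < T)
    (ht : t ∈ Set.Icc 0 T) :
    IsOffDiagonal (spectralProj σ (γ t)) (derivWithin γ (Set.Icc 0 T) t) := fun a => by
  have hγ := h.contDiffOn.differentiableOn one_ne_zero t ht
  have hres (u) (hu : u ∈ Set.Icc 0 T) := isSpectralResolution_spectralProj (h.mem u hu)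
  exact mul_deriv_mul_eq_zero (uniqueDiffOn_Icc hT t ht) ht hγ.hasDerivWithinAt
    (differentiableWithinAt_aeval hγ _).hasDerivWithinAt (fun u hu => (hres u hu).mul_eq_smul a)
    ((hres t ht).eq_smul_mul a)

theorem isVonNeumann (h : IsCurve σ T ρ₀ ρ₁ γ) (hħ : ħ ≠ 0) (hT : 0 < T) :
    IsVonNeumann ħ σ T ρ₀ ρ₁
      (fun t => horizontalHamiltonian ħ σ (γ t) (derivWithin γ (Set.Icc 0 T) t)) γ where
  selfAdjoint t ht :=
    isSelfAdjoint_horizontalHamiltonian ħ (h.mem t ht) (h.isSelfAdjoint_derivWithin ht)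
  continuousOn := by
    have hd := h.contDiffOn.continuousOn_derivWithin (uniqueDiffOn_Icc hT) le_rfl
    have hE (a) : ContinuousOn (fun t => spectralProj σ (γ t) a) (Set.Icc 0 T) :=
      (Polynomial.continuous_aeval _).comp_continuousOn h.contDiffOn.continuousOn
    unfold horizontalHamiltonian commutatorInv
    fun_prop
  mem := h.mem
  eqn t ht := by
    rw [hamField_horizontalHamiltonian hħ (h.mem t ht) (h.isOffDiagonal_derivWithin hT ht)]
    exact (h.contDiffOn.differentiableOn one_ne_zero t ht).hasDerivWithinAt
  left := h.left
  right := h.right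

theorem length_eq (h : IsCurve σ T ρ₀ ρ₁ γ) (hc : 0 < c) (hħ : 0 < ħ) (hT : 0 < T) :
    length c σ T γ = √c * energyIntegral ħ T
      (fun t => horizontalHamiltonian ħ σ (γ t) (derivWithin γ (Set.Icc 0 T) t)) γ := by
  have hγ := h.isVonNeumann hħ.ne' hT
  exact hγ.length_eq_of_sqrt_metric_eq hT fun t ht =>
    sqrt_metric_of_isOffDiagonal hc hħ (h.mem t ht) (hγ.selfAdjoint t ht)
      (isOffDiagonal_horizontalHamiltonian ħ (h.mem t ht) _)

end IsCurve

theorem isGLB_energyIntegral (hc : 0 < c) (hħ : 0 < ħ) (hτ : 0 < τ)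
    (h₀ : ρ₀ ∈ isospectral H σ) (h₁ : ρ₁ ∈ isospectral H σ) :
    IsGLB {r | ∃ A ρ : ℝ → H →L[ℂ] H, IsVonNeumann ħ σ τ ρ₀ ρ₁ A ρ ∧
      r = √c * energyIntegral ħ τ A ρ} (geodesicDist c σ ρ₀ ρ₁) := by
  constructor
  · rintro _ ⟨A, ρ, h, rfl⟩
    exact (geodesicDist_le_length (h.isCurve hτ) hτ c).trans (h.length_le hc hħ hτ)
  · intro b hb
    obtain ⟨A, ρ, h⟩ := exists_isVonNeumann h₀ h₁ hħ.ne' hτ.ne'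
    refine le_csInf ⟨_, τ, hτ, ρ, h.isCurve hτ, rfl⟩ ?_
    rintro _ ⟨T, hT, γ, hγ, rfl⟩
    rw [hγ.length_eq hc hħ hT, ← energyIntegral_rescale ħ hT.le hτ]
    exact hb ⟨_, _, (hγ.isVonNeumann hħ.ne' hT).rescale hT hτ, rfl⟩

end Curves

end

end MixedState

open MixedState in
theorem mainTheorem3 {H : Type*} [NormedAddCommGroup H] [InnerProductSpace ℂ H] [CompleteSpace H]
    [FiniteDimensional ℂ H] (σ : Spectrum) (ħ : ℝ) (hħ : 0 < ħ) (τ : ℝ) (hτ : 0 < τ)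
    (ρ₀ ρ₁ : H →L[ℂ] H) (h₀ : ρ₀ ∈ isospectral H σ) (h₁ : ρ₁ ∈ isospectral H σ) :
    -- the distance is the infimum of the energy-uncertainty integrals
    IsGLB {r | ∃ A ρ : ℝ → H →L[ℂ] H, IsVonNeumann ħ σ τ ρ₀ ρ₁ A ρ ∧ r = energyIntegral ħ τ A ρ}
      (geodesicDist 1 σ ρ₀ ρ₁) ∧
    -- each integral bounds the length of its curve
    (∀ A ρ : ℝ → H →L[ℂ] H, IsVonNeumann ħ σ τ ρ₀ ρ₁ A ρ →
      length 1 σ τ ρ ≤ energyIntegral ħ τ A ρ) ∧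
    -- with equality if the Hamiltonian generates a horizontal lift
    (∀ A ρ : ℝ → H →L[ℂ] H, IsVonNeumann ħ σ τ ρ₀ ρ₁ A ρ →
      GeneratesHorizontalLift 1 ħ σ τ A ρ → length 1 σ τ ρ = energyIntegral ħ τ A ρ) ∧
    -- the same for the metric `G(X, Y) = ħ Tr(X†Y + Y†X)`, which rescales all lengths
    IsGLB {r | ∃ A ρ : ℝ → H →L[ℂ] H, IsVonNeumann ħ σ τ ρ₀ ρ₁ A ρ ∧
      r = √(2 * ħ) * energyIntegral ħ τ A ρ} (geodesicDist (2 * ħ) σ ρ₀ ρ₁) := by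
  refine ⟨?_, fun A ρ h => ?_, fun A ρ h hlift => ?_,
    isGLB_energyIntegral (by positivity) hħ hτ h₀ h₁⟩
  · simpa using isGLB_energyIntegral one_pos hħ hτ h₀ h₁
  · simpa using h.length_le one_pos hħ hτ
  · simpa using h.length_eq_of_horizontal one_pos hħ hτ hlift
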